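/- **Setting.** Let $n$ agents $1,\dots,n$ run in synchronous rounds, round $m+1$ lying between times $m$ and $m+1$; agent $i$ starts with an initial value $v_i\in\{0,1\}$. Let $t\le n$. In the failure model $\mathit{Crash}_t$ at most $t$ agents crash in a run; an agent acts correctly until the round in which it crashes, in that round an arbitrary subset of its messages is delivered, and afterwards it sends nothing. From the end of the round of its crash on, its local state is $\mathit{crashed}$. Let $\mathcal N(r,m)$ be the set of agents whose local state at time $m$ of run $r$ is not $\mathit{crashed}$ (the nonfailed agents). In the *FloodSet information exchange* a nonfailed agent $i$ has at time $m$ a local state $\langle W_i,m,v_i\rangle$, with $W_i=\{v_i\}$ at time $0$. In each round it sends $W_i$ to all agents, and replaces $W_i$ by the union of $W_i$ and all sets received. Messages and states do not depend on the agents' decisions, so the set of runs $r$ does not depend on the decision protocol. Let $\mathcal I$ be the system of all these runs, for all initial values and all adversaries in $\mathit{Crash}_t$. At a point $(r,m)$ of $\mathcal I$, $\exists v$ says that some agent has initial value $v$ in $r$; $K_i\varphi$ says that $\varphi$ holds at all points $(r',m')$ of $\mathcal I$ at which $i$ has the same local state as at $(r,m)$; $E_{\mathcal N}\varphi$ says that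 $K_i\varphi$ holds for all $i\in\mathcal N(r,m)$; and $C_{\mathcal N}\varphi$ says that $E_{\mathcal N}^k\varphi$ holds for all $k\ge 1$. A *decision protocol* $P$ assigns to each local state of agent $i$ an action, $\mathtt{decide}_i(v)$ with $v\in\{0,1\}$ or $\mathtt{noop}$. It is an *SBA protocol* if in every run: any two decisions made by nonfailed agents, at the same or at different times, are on the same value (agreement); a value decided by a nonfailed agent is the initial value of some agent (validity); and if a nonfailed agent decides at a time, then every agent nonfailed at that time decides at that time (simultaneity). An SBA protocol $P$ is *optimum* for the exchange if for every SBA protocol $P'$ for the same exchange, all runs $r'$ of $P'$ and $r$ of $P$ with the same initial values and the same adversary, and every time $m$, each nonfailed agent that decides at time $m$ of $r'$ also decides (possibly on another value) at time $m$ of $r$. Let $P^{\mathrm{flood}+}$ be the decision protocol in which a nonfailed agent $i$ with state $\langle W_i,m,v_i\rangle$ does $\mathtt{decide}_i(\min W_i)$ if $m\ge\min\{t+1,n-1\}$, and $\mathtt{noop}$ otherwise. **Theorem.** (1) For every point $(r,m)$ of $\mathcal I$ and every $i\in\mathcal N(r,m)$, $$(\mathcal I,r,m)\models\bigvee_{v\in\{0,1\}}K_i\bigl(C_{\mathcal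 N}(\exists v)\bigr)\quad\text{if and only if}\quad m\ge\min\{t+1,n-1\}.$$ If $t<n$, it is also true at every point $(r,m)$ of $\mathcal I$ that $(\mathcal I,r,m)\models\bigvee_{v}K_i(C_{\mathcal N}(\exists v))$ holds for all $i\in\mathcal N(r,m)$ if and only if $m\ge\min\{t+1,n-1\}$. (2) $P^{\mathrm{flood}+}$ is an optimum SBA protocol for the FloodSet information exchange in $\mathit{Crash}_t$, and it terminates: in every run every agent eventually decides or fails. -/

import Mathlib

namespace SBA

/-- The set of initial values `{0, 1}`. -/
abbrev Value := Fin 2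

/-- The actions of an agent. -/
inductive Action where
  | decideVal (v : Value)
  | noop

/-- Adversaries. `F m i j = true` means that the message that agent `i` is supposed to send to
agent `j` in round `m + 1` (the round between time `m` and time `m + 1`) is delivered, and
`F m i i = false` means that agent `i` has crashed in round `m + 1` or earlier. -/
abbrev Adversary (n : ℕ) := ℕ → Fin n → Fin n → Bool

/-- The hard crash failure model with at most `t` faulty agents: an agent omits a message only in
the round in which it crashes or later, in the round of the crash an arbitrary subset of its
messages is delivered, and after that round none is. -/
def Crash (n t : ℕ) : Set (Adversary n) :=
  {F | (∀ m i j, F m i j = false → F m i i = false) ∧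
    (∀ m i, F m i i = false → ∀ m', m < m' → ∀ k, F m' i k = false) ∧
    {i : Fin n | ∃ m j, F m i j = false}.ncard ≤ t}

/-- Information exchange protocols for `n` agents in the crash failure model. The initial states
of agent `i` are the states `initState i v`, one for each initial value `v`. -/
structure InfoExchange (n : ℕ) where
  /-- local states -/
  Loc : Fin n → Type
  /-- the special local state of an agent that has crashed -/
  crashed : ∀ i, Loc i
  /-- the initial local state with a given initial value -/
  initState : ∀ i, Value → Loc i
  initState_injective : ∀ i, Function.Injective (initState i)
  /-- messages; the absence of a message is `none` in `Option (Msg i)` -/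
  Msg : Fin n → Type
  /-- message selection -/
  select : ∀ i, Loc i → Action → Fin n → Option (Msg i)
  /-- state update; the last argument is the vector of received messages -/
  update : ∀ i, Loc i → Adversary n → Action → (∀ j, Option (Msg j)) → Loc i

variable {n : ℕ}

/-- Decision protocols for an information exchange. -/
abbrev DecisionProtocol (E : InfoExchange n) := ∀ i, E.Loc i → Action

/-- Global states: the state of the environment (an adversary) and a local state of each agent. -/
structure GlobalState (E : InfoExchange n) where
  env : Adversary n
  loc : ∀ i, E.Loc i

/-- Mappings from times to global states. -/
abbrev Run (E : InfoExchange n) := ℕ → GlobalState E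

/-- The global state at time `k + 1` if the one at time `k` is `g`. -/
def step {E : InfoExchange n} (P : DecisionProtocol E) (k : ℕ) (g : GlobalState E) :
    GlobalState E where
  env := g.env
  loc := fun i => E.update i (g.loc i) g.env (P i (g.loc i))
    (fun j => if g.env k j i then E.select j (g.loc j) (P j (g.loc j)) i else none)

/-- The runs of the protocol `(P, E)` in the failure model `Crash n t`. -/
def Runs (E : InfoExchange n) (P : DecisionProtocol E) (t : ℕ) : Set (Run E) :=
  {r | (r 0).env ∈ Crash n t ∧ (∀ i, ∃ v, (r 0).loc i = E.initState i v) ∧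
    ∀ k, r (k + 1) = step P k (r k)}

/-- `HasInit r i v`: agent `i` has initial value `v` in the run `r`. -/
def HasInit {E : InfoExchange n} (r : Run E) (i : Fin n) (v : Value) : Prop :=
  (r 0).loc i = E.initState i v

/-- The indexical set of nonfailed agents. -/
def Nonfailed {E : InfoExchange n} (r : Run E) (m : ℕ) : Set (Fin n) :=
  {i | (r m).loc i ≠ E.crashed i}

/-- Atomic propositions: "some agent has initial value `v`" and "agent `i` has not failed". -/
inductive Atom (n : ℕ) where
  | existsVal (v : Value)
  | nonfailed (i : Fin n)

/-- Interpreted systems: a set of runs with an interpretation of the atomic propositions. -/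
structure InterpretedSystem (E : InfoExchange n) where
  runs : Set (Run E)
  interp : Run E → ℕ → Atom n → Prop

/-- The interpreted system generated by `(P, E)` in the failure model `Crash n t`. -/
def system (E : InfoExchange n) (P : DecisionProtocol E) (t : ℕ) : InterpretedSystem E where
  runs := Runs E P t
  interp := fun r m a => match a with
    | Atom.existsVal v => ∃ i, HasInit r i v
    | Atom.nonfailed i => i ∈ Nonfailed r m

/-- Formulas of the logic of knowledge and common knowledge among the nonfailed agents. -/
inductive Formula (n : ℕ) where
  | atom (a : Atom n)
  | neg (φ : Formula n)
  | and (φ ψ : Formula n)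
  | or (φ ψ : Formula n)
  | know (i : Fin n) (φ : Formula n)
  | everyone (φ : Formula n)
  | common (φ : Formula n)

/-- The semantic operator `K i` on properties of points. -/
def Knows {E : InfoExchange n} (I : InterpretedSystem E) (i : Fin n) (A : Run E → ℕ → Prop)
    (r : Run E) (m : ℕ) : Prop :=
  ∀ r' ∈ I.runs, ∀ m', (r m).loc i = (r' m').loc i → A r' m'

/-- The semantic operator "every nonfailed agent knows" on properties of points. -/
def EveryoneKnows {E : InfoExchange n} (I : InterpretedSystem E) (A : Run E → ℕ → Prop)
    (r : Run E) (m : ℕ) : Prop :=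
  ∀ i ∈ Nonfailed r m, Knows I i A r m

/-- `Sat I φ r m`: the formula `φ` is true at the point `(r, m)` of `I`. -/
def Sat {E : InfoExchange n} (I : InterpretedSystem E) : Formula n → Run E → ℕ → Prop
  | Formula.atom a => fun r m => I.interp r m a
  | Formula.neg φ => fun r m => ¬ Sat I φ r m
  | Formula.and φ ψ => fun r m => Sat I φ r m ∧ Sat I ψ r m
  | Formula.or φ ψ => fun r m => Sat I φ r m ∨ Sat I ψ r m
  | Formula.know i φ => Knows I i (Sat I φ)
  | Formula.everyone φ => EveryoneKnows I (Sat I φ)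
  | Formula.common φ => fun r m => ∀ k : ℕ, 1 ≤ k → (EveryoneKnows I)^[k] (Sat I φ) r m

/-- `Decides P r m i v`: agent `i` has not failed at time `m` of `r`, and `P` lets it decide `v`
in round `m + 1`. -/
def Decides {E : InfoExchange n} (P : DecisionProtocol E) (r : Run E) (m : ℕ) (i : Fin n)
    (v : Value) : Prop :=
  i ∈ Nonfailed r m ∧ P i ((r m).loc i) = Action.decideVal v

/-- SBA protocols: agreement (also between different times), validity and simultaneity. -/
structure IsSBA (E : InfoExchange n) (t : ℕ) (P : DecisionProtocol E) : Prop where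
  agreement : ∀ r ∈ Runs E P t, ∀ m m' i j v v',
    Decides P r m i v → Decides P r m' j v' → v = v'
  validity : ∀ r ∈ Runs E P t, ∀ m i v, Decides P r m i v → ∃ j, HasInit r j v
  simultaneity : ∀ r ∈ Runs E P t, ∀ m i v, Decides P r m i v →
    ∀ j ∈ Nonfailed r m, ∃ w, Decides P r m j w

/-- Termination: every agent eventually decides or fails. -/
def Terminates (E : InfoExchange n) (t : ℕ) (P : DecisionProtocol E) : Prop :=
  ∀ r ∈ Runs E P t, ∀ i, ∃ m, i ∉ Nonfailed r m ∨ ∃ v, Decides P r m i v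

/-- Corresponding runs: the same initial values and the same adversary. -/
def Correspond {E E' : InfoExchange n} (r : Run E) (r' : Run E') : Prop :=
  (∀ i v, HasInit r i v ↔ HasInit r' i v) ∧ (r 0).env = (r' 0).env

/-- `P ≤ P'`: whenever a nonfailed agent decides with `P`, it also decides, possibly on another
value, with `P'` at the same time of the corresponding run. -/
def ProtocolLE (E : InfoExchange n) (t : ℕ) (P P' : DecisionProtocol E) : Prop :=
  ∀ r ∈ Runs E P t, ∀ r' ∈ Runs E P' t, Correspond r r' →
    ∀ m i v, Decides P r m i v → ∃ w, Decides P' r' m i w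

/-- Optimum SBA protocols with respect to an information exchange. -/
def IsOptimumSBA (E : InfoExchange n) (t : ℕ) (P : DecisionProtocol E) : Prop :=
  IsSBA E t P ∧ ∀ P' : DecisionProtocol E, IsSBA E t P' → ProtocolLE E t P' P

/-- Local states of the FloodSet information exchange: the state of a crashed agent, or the set
`W` of values seen so far with the current time `m` and the initial value `v` of the agent. -/
inductive FloodState where
  | crashed
  | live (W : Finset Value) (m : ℕ) (v : Value)

/-- The FloodSet information exchange. -/
def flood (n : ℕ) : InfoExchange n where
  Loc := fun _ => FloodState
  crashed := fun _ => FloodState.crashed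
  initState := fun _ v => FloodState.live {v} 0 v
  initState_injective := fun _ v w h => by
    injection h
  Msg := fun _ => Finset Value
  select := fun _ s _ _ => match s with
    | FloodState.crashed => none
    | FloodState.live W _ _ => some W
  update := fun i s F _ msg => match s with
    | FloodState.crashed => FloodState.crashed
    | FloodState.live W m v =>
      if F m i i then
        FloodState.live (W ∪ Finset.univ.biUnion fun j => (msg j).getD ∅) (m + 1) v
      else FloodState.crashed

/-- The modified FloodSet decision protocol: decide the least value seen so far as soon as the
time is at least `min (t + 1) (n - 1)`. (The set `W` is nonempty in every state that occurs.) -/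
def floodPlus (n t : ℕ) : DecisionProtocol (flood n) := fun _ s => match s with
  | FloodState.crashed => Action.noop
  | FloodState.live W m _ =>
    if min (t + 1) (n - 1) ≤ m then
      if h : W.Nonempty then Action.decideVal (W.min' h) else Action.noop
    else Action.noop

/-- The formula `⋁ v, K i (C (∃ v))`, where `v` ranges over the values `0` and `1`. -/
def knowsCommonValue (i : Fin n) : Formula n :=
  Formula.or
    (Formula.know i (Formula.common (Formula.atom (Atom.existsVal 0))))
    (Formula.know i (Formula.common (Formula.atom (Atom.existsVal 1))))

end SBA

/-!
An SBA protocol can decide `x` only where `∃ x` is common knowledge, since the points at which `x`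
is decided are closed under what nonfailed agents cannot distinguish. So both parts of the theorem
come down to the time at which some `∃ x` becomes common knowledge.

A run is determined by its adversary and its initial values, and the state of a nonfailed agent by
the time, its initial value and the set of values it has seen. After a round without a crash all
nonfailed agents have seen the same values, and this persists. If each of the first `m` rounds has
a crash, where `m ≥ min (t + 1) (n - 1)`, then `m ≤ t`, hence `n - 1 ≤ m`, and at most one agent is
left. So from time `min (t + 1) (n - 1)` on, the existence of any value that a nonfailed agent has
seen is common knowledge.

At an earlier time any two points with nonfailed agents are linked by a chain of indistinguishable
points, so no `∃ x` is common knowledge. The essential link leads from the failure-free run in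
which all values are `x` to one with mixed values: agent `0` gets a value `y ≠ x`, which is passed
along the agents `0, …, m` by senders that crash, so that at time `m` agent `m` has seen `y` and
the agents after it have not.
-/

namespace SBA

theorem Value.eq_or_eq_of_ne {x y : Value} (h : x ≠ y) (z : Value) : z = x ∨ z = y := by
  decide +revert

theorem Value.surjective_of_ne {α : Type*} {v : α → Value} {i j : α} (h : v i ≠ v j) :
    v.Surjective :=
  fun x => (eq_or_eq_of_ne h x).elim (fun hx => ⟨i, hx.symm⟩) fun hx => ⟨j, hx.symm⟩

theorem Value.finset_eq_univ_of_ne {S : Finset Value} {x y : Value} (hx : x ∈ S) (hy : y ∈ S)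
    (h : x ≠ y) : S = Finset.univ :=
  Finset.eq_univ_of_forall fun z => (eq_or_eq_of_ne h z).elim (· ▸ hx) (· ▸ hy)

section CommonKnowledge

variable {n t : ℕ} {E : InfoExchange n} {I : InterpretedSystem E} {φ : Formula n} {r : Run E}
  {m : ℕ} {i : Fin n}

theorem Sat.know_common (h : Sat I (.common φ) r m) (hi : i ∈ Nonfailed r m) :
    Sat I (.know i (.common φ)) r m := by
  intro r' hr' m' hloc k _
  have hsucc := h (k + 1) (Nat.le_add_left 1 k)
  rw [Function.iterate_succ_apply'] at hsucc
  exact hsucc i hi r' hr' m' hloc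

theorem Sat.of_common (h : Sat I (.common φ) r m) (hr : r ∈ I.runs) (hi : i ∈ Nonfailed r m) :
    Sat I φ r m :=
  h 1 le_rfl i hi r hr m rfl

theorem sat_common_of_invariant {A : Run E → ℕ → Prop}
    (hA : ∀ r m, A r m → EveryoneKnows I (fun r' m' => A r' m' ∧ Sat I φ r' m') r m)
    (h : A r m) : Sat I (.common φ) r m := by
  intro k hk
  induction k, hk using Nat.le_induction generalizing r m with
  | base => exact fun i hi r' hr' m' hloc => (hA r m h i hi r' hr' m' hloc).2
  | succ k _ ih =>
    rw [Function.iterate_succ_apply']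
    exact fun i hi r' hr' m' hloc => ih (hA r m h i hi r' hr' m' hloc).1

theorem sat_knowsCommonValue :
    Sat I (knowsCommonValue i) r m ↔
      ∃ x, Sat I (.know i (.common (.atom (.existsVal x)))) r m :=
  (Fin.exists_fin_two (p := fun x => Sat I (.know i (.common (.atom (.existsVal x)))) r m)).symm

variable {P : DecisionProtocol E}

theorem Decides.of_loc_eq {r' : Run E} {m' : ℕ} {x : Value} (h : Decides P r m i x)
    (hloc : (r m).loc i = (r' m').loc i) : Decides P r' m' i x :=
  ⟨fun hc => h.1 (hloc.trans hc), hloc ▸ h.2⟩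

theorem IsSBA.decides_of_decides (hP : IsSBA E t P) (hr : r ∈ Runs E P t) {x : Value}
    (h : Decides P r m i x) {j : Fin n} (hj : j ∈ Nonfailed r m) : Decides P r m j x := by
  obtain ⟨y, hy⟩ := hP.simultaneity r hr m i x h j hj
  rwa [hP.agreement r hr m m i j x y h hy]

theorem IsSBA.sat_common_existsVal (hP : IsSBA E t P) (hr : r ∈ Runs E P t) {x : Value}
    (h : Decides P r m i x) :
    Sat (system E P t) (.common (.atom (.existsVal x))) r m := by
  refine sat_common_of_invariant
    (A := fun r m => r ∈ Runs E P t ∧ ∃ i, Decides P r m i x) ?_ ⟨hr, i, h⟩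
  rintro r m ⟨hr, i, h⟩ j hj r' hr' m' hloc
  have hj' : Decides P r' m' j x := (hP.decides_of_decides hr h hj).of_loc_eq hloc
  exact ⟨⟨hr', j, hj'⟩, hP.validity r' hr' m' j x hj'⟩

theorem IsSBA.sat_knowsCommonValue (hP : IsSBA E t P) (hr : r ∈ Runs E P t) {x : Value}
    (h : Decides P r m i x) : Sat (system E P t) (knowsCommonValue i) r m :=
  SBA.sat_knowsCommonValue.2 ⟨x, (hP.sat_common_existsVal hr h).know_common h.1⟩

end CommonKnowledge

/-- What determines a run of a given protocol: an adversary of `Crash n t` together with an initial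
value of each agent. -/
structure Scenario (n t : ℕ) where
  adv : Adversary n
  adv_mem : adv ∈ Crash n t
  initVal : Fin n → Value

namespace Scenario

variable {n t : ℕ}

section Run

variable {E : InfoExchange n}

/-- The run of the protocol `P` in the scenario `s`. -/
def run (s : Scenario n t) (P : DecisionProtocol E) : Run E
  | 0 => ⟨s.adv, fun i => E.initState i (s.initVal i)⟩
  | m + 1 => step P m (s.run P m)

theorem mem_runs_iff {P : DecisionProtocol E} {r : Run E} :
    r ∈ Runs E P t ↔ ∃ s : Scenario n t, s.run P = r := by
  constructor
  · rintro ⟨hadv, hval, hstep⟩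
    choose v hv using hval
    refine ⟨⟨(r 0).env, hadv, v⟩, funext fun m => ?_⟩
    induction m with
    | zero => exact congrArg (GlobalState.mk (r 0).env) (funext hv).symm
    | succ m ih => exact (congrArg (step P m) ih).trans (hstep m).symm
  · rintro ⟨s, rfl⟩
    exact ⟨s.adv_mem, fun i => ⟨s.initVal i, rfl⟩, fun _ => rfl⟩

theorem run_mem_runs (s : Scenario n t) (P : DecisionProtocol E) : s.run P ∈ Runs E P t :=
  mem_runs_iff.2 ⟨s, rfl⟩

theorem env_run (s : Scenario n t) (P : DecisionProtocol E) (m : ℕ) :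
    (s.run P m).env = s.adv := by
  induction m with
  | zero => rfl
  | succ _ ih => exact ih

theorem hasInit_run {s : Scenario n t} {P : DecisionProtocol E} {i : Fin n} {x : Value} :
    HasInit (s.run P) i x ↔ s.initVal i = x :=
  (E.initState_injective i).eq_iff

end Run

variable {s s' : Scenario n t} {m m' : ℕ} {i j : Fin n} {x : Value}

/-- The agents that have not crashed by time `m`. -/
def alive (s : Scenario n t) (m : ℕ) : Set (Fin n) :=
  {i | ∀ k < m, s.adv k i i = true}

theorem mem_alive_zero (s : Scenario n t) (i : Fin n) : i ∈ s.alive 0 :=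
  fun k hk => absurd hk k.not_lt_zero

theorem mem_alive_succ : i ∈ s.alive (m + 1) ↔ i ∈ s.alive m ∧ s.adv m i i = true :=
  Nat.forall_lt_succ_right

theorem alive_antitone (s : Scenario n t) : Antitone s.alive :=
  fun _ _ hm _ hi k hk => hi k (hk.trans_le hm)

theorem mem_alive_of_delivered (h : s.adv m i j = true) : i ∈ s.alive m := by
  intro k hk
  by_contra hcrash
  exact absurd h (by simp [s.adv_mem.2.1 k i (by simpa using hcrash) m hk j])

theorem delivered_of_mem_alive_succ (hi : i ∈ s.alive (m + 1)) (j : Fin n) :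
    s.adv m i j = true := by
  by_contra hlost
  exact absurd (hi m m.lt_succ_self) (by simp [s.adv_mem.1 m i j (by simpa using hlost)])

theorem le_ncard_alive_add (s : Scenario n t) (m : ℕ) : n ≤ (s.alive m).ncard + t := by
  have hfaulty : (s.alive m)ᶜ ⊆ {i | ∃ k j, s.adv k i j = false} := by
    intro i hi
    simp only [alive, Set.mem_compl_iff, Set.mem_ofPred_eq, not_forall] at hi
    obtain ⟨k, -, hk⟩ := hi
    exact ⟨k, i, by simpa using hk⟩
  have hcompl := Set.ncard_add_ncard_compl (s.alive m)
  rw [Nat.card_eq_fintype_card, Fintype.card_fin] at hcompl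
  have hle := (Set.ncard_le_ncard hfaulty).trans s.adv_mem.2.2
  omega

theorem alive_nonempty (s : Scenario n t) (ht : t < n) (m : ℕ) : (s.alive m).Nonempty := by
  have hle := s.le_ncard_alive_add m
  exact Set.nonempty_of_ncard_ne_zero (by omega)

theorem ncard_alive_add_le (h : ∀ k < m, s.alive (k + 1) ≠ s.alive k) :
    (s.alive m).ncard + m ≤ n := by
  induction m with
  | zero => simpa using Set.ncard_le_card (s.alive 0)
  | succ m ih =>
    have hlt : (s.alive (m + 1)).ncard < (s.alive m).ncard := Set.ncard_lt_ncard
      ((s.alive_antitone m.le_succ).ssubset_of_ne (h m m.lt_succ_self))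
    have hle := ih fun k hk => h k (hk.trans m.lt_succ_self)
    omega

/-- The set of values that agent `i` has seen by time `m` in the FloodSet exchange. The recursion
also makes sense for a crashed agent, which goes on receiving, but never sends. -/
def seen (s : Scenario n t) : ℕ → Fin n → Finset Value
  | 0, i => {s.initVal i}
  | m + 1, i => s.seen m i ∪ Finset.univ.biUnion fun j => if s.adv m j i then s.seen m j else ∅

theorem mem_seen_succ :
    x ∈ s.seen (m + 1) i ↔ x ∈ s.seen m i ∨ ∃ j, s.adv m j i = true ∧ x ∈ s.seen m j := by
  simp only [seen, Finset.mem_union, Finset.mem_biUnion, Finset.mem_univ, true_and]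
  refine or_congr_right (exists_congr fun j => ?_)
  split_ifs with h <;> simp [h]

theorem initVal_mem_seen (s : Scenario n t) (m : ℕ) (i : Fin n) : s.initVal i ∈ s.seen m i := by
  induction m with
  | zero => exact Finset.mem_singleton_self _
  | succ m ih => exact mem_seen_succ.2 (.inl ih)

theorem exists_initVal_of_mem_seen (h : x ∈ s.seen m i) : ∃ j, s.initVal j = x := by
  induction m generalizing i with
  | zero => exact ⟨i, (Finset.mem_singleton.1 h).symm⟩
  | succ m ih =>
    rcases mem_seen_succ.1 h with h | ⟨j, -, h⟩
    exacts [ih h, ih h]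

theorem seen_eq_singleton (h : ∀ x ∈ s.seen m i, x = s.initVal i) : s.seen m i = {s.initVal i} :=
  Finset.eq_singleton_iff_unique_mem.2 ⟨s.initVal_mem_seen m i, h⟩

theorem loc_run_of_mem_alive (P : DecisionProtocol (flood n)) (hi : i ∈ s.alive m) :
    (s.run P m).loc i = FloodState.live (s.seen m i) m (s.initVal i) := by
  induction m generalizing i with
  | zero => rfl
  | succ m ih =>
    obtain ⟨hi, hself⟩ := mem_alive_succ.1 hi
    simp only [run, step, env_run, ih hi]
    refine (if_pos hself).trans ?_
    refine congrArg (fun S => FloodState.live (s.seen m i ∪ S) (m + 1) (s.initVal i))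
      (Finset.biUnion_congr rfl fun j _ => ?_)
    by_cases hj : s.adv m j i = true
    · have hsent : (flood n).select j ((s.run P m).loc j) (P j ((s.run P m).loc j)) i =
          some (s.seen m j) := by
        rw [ih (mem_alive_of_delivered hj)]
        rfl
      rw [if_pos hj]
      exact congrArg (Option.getD (α := Finset Value) · ∅) ((if_pos hj).trans hsent)
    · rw [if_neg hj]
      exact congrArg (Option.getD (α := Finset Value) · ∅) (if_neg hj)

theorem loc_run_of_notMem_alive (P : DecisionProtocol (flood n)) (hi : i ∉ s.alive m) :
    (s.run P m).loc i = FloodState.crashed := by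
  induction m with
  | zero => exact absurd (s.mem_alive_zero i) hi
  | succ m ih =>
    by_cases halive : i ∈ s.alive m
    · have hself : ¬ s.adv m i i = true := fun h => hi (mem_alive_succ.2 ⟨halive, h⟩)
      simp only [run, step, env_run, loc_run_of_mem_alive P halive]
      exact if_neg hself
    · simp only [run, step, ih halive]
      rfl

theorem nonfailed_run (s : Scenario n t) (P : DecisionProtocol (flood n)) (m : ℕ) :
    Nonfailed (s.run P) m = s.alive m := by
  ext i
  refine ⟨fun h => not_imp_comm.1 (loc_run_of_notMem_alive P) h, fun hi hcrashed => ?_⟩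
  exact FloodState.noConfusion ((loc_run_of_mem_alive P hi).symm.trans hcrashed)

theorem loc_run_eq_iff {P : DecisionProtocol (flood n)} (hi : i ∈ s.alive m) :
    (s.run P m).loc i = (s'.run P m').loc i ↔
      i ∈ s'.alive m' ∧ m = m' ∧ s.seen m i = s'.seen m' i ∧ s.initVal i = s'.initVal i := by
  rw [loc_run_of_mem_alive P hi]
  by_cases hi' : i ∈ s'.alive m'
  · rw [loc_run_of_mem_alive P hi']
    exact (FloodState.live.injEq ..).to_iff.trans (by tauto)
  · rw [loc_run_of_notMem_alive P hi']
    exact iff_of_false FloodState.noConfusion fun h => hi' h.1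

/-- All agents alive at time `m` have seen the same values. -/
def SeenUniform (s : Scenario n t) (m : ℕ) : Prop :=
  ∀ i ∈ s.alive m, ∀ j ∈ s.alive m, s.seen m i = s.seen m j

theorem SeenUniform.seen_eq (h : s.SeenUniform m) (hm : m ≤ m') (hi : i ∈ s.alive m')
    (hj : j ∈ s.alive m) : s.seen m' i = s.seen m j := by
  induction m', hm using Nat.le_induction generalizing i with
  | base => exact h i hi j hj
  | succ k _ ih =>
    have hi := s.alive_antitone k.le_succ hi
    ext x
    rw [mem_seen_succ, ih hi]
    refine ⟨?_, .inl⟩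
    rintro (hx | ⟨l, hl, hx⟩)
    · exact hx
    · rwa [ih (mem_alive_of_delivered hl)] at hx

theorem SeenUniform.mono (h : s.SeenUniform m) (hm : m ≤ m') : s.SeenUniform m' :=
  fun _ hi _ hj => (h.seen_eq hm hi (s.alive_antitone hm hi)).trans
    (h.seen_eq hm hj (s.alive_antitone hm hi)).symm

theorem seenUniform_succ_of_alive_eq (h : s.alive (m + 1) = s.alive m) :
    s.SeenUniform (m + 1) := by
  have hseen : ∀ i ∈ s.alive (m + 1), ∀ x,
      x ∈ s.seen (m + 1) i ↔ ∃ j ∈ s.alive m, x ∈ s.seen m j := by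
    intro i hi x
    rw [mem_seen_succ]
    constructor
    · rintro (hx | ⟨j, hj, hx⟩)
      exacts [⟨i, h ▸ hi, hx⟩, ⟨j, mem_alive_of_delivered hj, hx⟩]
    · rintro ⟨j, hj, hx⟩
      exact .inr ⟨j, delivered_of_mem_alive_succ (h ▸ hj) i, hx⟩
  intro i hi j hj
  ext x
  rw [hseen i hi, hseen j hj]

theorem seenUniform_of_le (s : Scenario n t) (hm : min (t + 1) (n - 1) ≤ m) :
    s.SeenUniform m := by
  by_cases hclean : ∃ k < m, s.alive (k + 1) = s.alive k
  · obtain ⟨k, hk, hclean⟩ := hclean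
    exact (seenUniform_succ_of_alive_eq hclean).mono hk
  · push Not at hclean
    have hupper := ncard_alive_add_le hclean
    have hlower := s.le_ncard_alive_add m
    have hone : (s.alive m).ncard ≤ 1 := by omega
    intro i hi j hj
    rw [(Set.ncard_le_one_iff (Set.toFinite _)).1 hone hi hj]

theorem sat_common_existsVal (P : DecisionProtocol (flood n))
    (hm : min (t + 1) (n - 1) ≤ m) (hx : ∀ i ∈ s.alive m, x ∈ s.seen m i) :
    Sat (system (flood n) P t) (.common (.atom (.existsVal x))) (s.run P) m := by
  refine sat_common_of_invariant
    (A := fun r m => ∃ s : Scenario n t, s.run P = r ∧ min (t + 1) (n - 1) ≤ m ∧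
      ∀ i ∈ s.alive m, x ∈ s.seen m i) ?_ ⟨s, rfl, hm, hx⟩
  rintro _ m ⟨s, rfl, hm, hx⟩ i hi _ hr' m' hloc
  obtain ⟨s', rfl⟩ := mem_runs_iff.1 hr'
  rw [nonfailed_run] at hi
  obtain ⟨hi', rfl, hseen, -⟩ := (loc_run_eq_iff hi).1 hloc
  have hx' : x ∈ s'.seen m i := hseen ▸ hx i hi
  obtain ⟨j, hj⟩ := exists_initVal_of_mem_seen hx'
  exact ⟨⟨s', rfl, hm, fun k hk => s'.seenUniform_of_le hm i hi' k hk ▸ hx'⟩,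
    j, hasInit_run.2 hj⟩

/-- The points `(s, m)` and `(s', m)` have the same state of some nonfailed agent. -/
def Indist (m : ℕ) (s s' : Scenario n t) : Prop :=
  ∃ i, i ∈ s.alive m ∧ i ∈ s'.alive m ∧ s.seen m i = s'.seen m i ∧ s.initVal i = s'.initVal i

/-- The points `(s, m)` and `(s', m)` are joined by a path of points in which neighbours have the
same state of some nonfailed agent. -/
def Reachable (m : ℕ) : Scenario n t → Scenario n t → Prop :=
  Relation.ReflTransGen (Indist m)

theorem Indist.reachable (h : Indist m s s') : Reachable m s s' :=
  .single h

theorem Reachable.trans {s'' : Scenario n t} (h : Reachable m s s') (h' : Reachable m s' s'') :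
    Reachable m s s'' :=
  Relation.ReflTransGen.trans h h'

theorem Reachable.symm (h : Reachable m s s') : Reachable m s' s :=
  have : Std.Symm (Indist (n := n) (t := t) m) :=
    ⟨fun _ _ ⟨i, hi, hi', hseen, hval⟩ => ⟨i, hi', hi, hseen.symm, hval.symm⟩⟩
  symm_of (Relation.ReflTransGen (Indist m)) h

theorem Reachable.sat_common {P : DecisionProtocol (flood n)} {φ : Formula n}
    (h : Reachable m s s') (hs : Sat (system (flood n) P t) (.common φ) (s.run P) m) :
    Sat (system (flood n) P t) (.common φ) (s'.run P) m := by
  induction h with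
  | refl => exact hs
  | @tail s₁ s₂ _ h ih =>
    obtain ⟨i, hi, hi', hseen, hval⟩ := h
    exact ih.know_common (s₁.nonfailed_run P m ▸ hi) (s₂.run P) (s₂.run_mem_runs P) m
      ((loc_run_eq_iff hi).2 ⟨hi', rfl, hseen, hval⟩)

/-- The scenario with initial values `v` in which no agent crashes. -/
def failureFree (v : Fin n → Value) : Scenario n t where
  adv _ _ _ := true
  adv_mem := by simp [Crash]
  initVal := v

theorem mem_alive_failureFree (v : Fin n → Value) (m : ℕ) (i : Fin n) :
    i ∈ (failureFree v : Scenario n t).alive m :=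
  fun _ _ => rfl

theorem seen_failureFree_const (x : Value) (m : ℕ) (i : Fin n) :
    (failureFree (fun _ => x) : Scenario n t).seen m i = {x} :=
  seen_eq_singleton fun _ hy => (exists_initVal_of_mem_seen hy).choose_spec.symm

theorem seen_failureFree_of_surjective {v : Fin n → Value} (hv : v.Surjective) (hm : 0 < m)
    (i : Fin n) : (failureFree v : Scenario n t).seen m i = Finset.univ := by
  obtain ⟨m, rfl⟩ := Nat.exists_eq_add_of_lt hm
  refine Finset.eq_univ_of_forall fun x => ?_
  obtain ⟨j, rfl⟩ := hv x
  exact mem_seen_succ.2 (.inr ⟨j, rfl, initVal_mem_seen _ _ j⟩)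

theorem indist_failureFree_of_seen_eq_univ (hm : 0 < m) (hi : i ∈ s.alive m)
    (h : s.seen m i = Finset.univ) {v : Fin n → Value} (hv : v.Surjective)
    (hval : s.initVal i = v i) : Indist m s (failureFree v) :=
  ⟨i, hi, mem_alive_failureFree v m i,
    h.trans (seen_failureFree_of_surjective hv hm i).symm, hval⟩

theorem reachable_failureFree_of_surjective (hn : 2 < n) (hm : 0 < m) {u v : Fin n → Value}
    (hu : u.Surjective) (hv : v.Surjective) :
    Reachable m (failureFree u : Scenario n t) (failureFree v) := by
  obtain ⟨i, j, k, hij, hik, hjk⟩ :=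
    Fintype.two_lt_card_iff.1 (hn.trans_eq (Fintype.card_fin n).symm)
  obtain ⟨y, hy⟩ := exists_ne (u i)
  let c : Fin n → Value := Function.update (Function.update (fun _ => y) i (u i)) j (v j)
  have hci : c i = u i := by simp [c, hij]
  have hcj : c j = v j := by simp [c]
  have hck : c k = y := by simp [c, hik.symm, hjk.symm]
  have hc : c.Surjective := Value.surjective_of_ne (i := k) (j := i) (by rwa [hck, hci])
  have hseen {w : Fin n → Value} (hw : w.Surjective) (l : Fin n) :=
    seen_failureFree_of_surjective (t := t) hw hm l
  exact (indist_failureFree_of_seen_eq_univ hm (mem_alive_failureFree u m i) (hseen hu i) hc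
      hci.symm).reachable.trans
    (indist_failureFree_of_seen_eq_univ hm (mem_alive_failureFree c m j) (hseen hc j) hv
      hcj).reachable

/-- The scenario with initial values `v` in which the agents `0, …, m - 1` crash one after the
other, agent `i` in round `i + 1`, where it reaches agent `i + 1` only. -/
def crashChain (m : ℕ) (hm : m ≤ t) (v : Fin n → Value) : Scenario n t where
  adv k i j := decide (m ≤ i.val ∨ k < i.val ∨ (k = i.val ∧ j.val = i.val + 1))
  adv_mem := by
    simp only [Crash, Set.mem_ofPred_eq, decide_eq_false_iff_not]
    refine ⟨by omega, by omega, ?_⟩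
    refine (Set.ncard_le_ncard_of_injOn (t := Set.Iio m) Fin.val ?_
      Fin.val_injective.injOn).trans ?_
    · rintro i ⟨k, j, h⟩
      exact Set.mem_Iio.2 (by omega)
    · simpa using hm
  initVal := v

theorem mem_alive_crashChain (hmt : m ≤ t) (v : Fin n → Value) (hi : m ≤ i.val) (k : ℕ) :
    i ∈ (crashChain m hmt v).alive k :=
  fun _ _ => decide_eq_true (.inl hi)

theorem exists_initVal_of_mem_seen_crashChain {hmt : m ≤ t} {v : Fin n → Value} {k : ℕ}
    (hk : k ≤ m) (hi : k < i.val) (hx : x ∈ (crashChain m hmt v).seen k i) :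
    ∃ j, 0 < j.val ∧ v j = x := by
  induction k generalizing i with
  | zero => exact ⟨i, hi, (Finset.mem_singleton.1 hx).symm⟩
  | succ k ih =>
    rcases mem_seen_succ.1 hx with hx | ⟨j, hj, hx⟩
    · exact ih (by omega) (by omega) hx
    · simp only [crashChain, decide_eq_true_eq] at hj
      exact ih (by omega) (by omega) hx

theorem initVal_zero_mem_seen_crashChain (hmt : m ≤ t) (v : Fin n → Value) {k : ℕ} (hk : k < n) :
    v ⟨0, k.zero_le.trans_lt hk⟩ ∈ (crashChain m hmt v).seen k ⟨k, hk⟩ := by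
  induction k with
  | zero => exact Finset.mem_singleton_self _
  | succ k ih =>
    exact mem_seen_succ.2 (.inr ⟨⟨k, k.lt_succ_self.trans hk⟩, by simp [crashChain], ih _⟩)

theorem exists_reachable_failureFree_surjective_of_const (hm : 0 < m) (hmt : m ≤ t)
    (hmn : m + 1 < n) (x : Value) : ∃ v : Fin n → Value, v.Surjective ∧
      Reachable m (failureFree fun _ => x : Scenario n t) (failureFree v) := by
  obtain ⟨y, hy⟩ := exists_ne x
  let v : Fin n → Value := fun i => if i.val = 0 then y else x
  have hvpos (i : Fin n) (hi : 0 < i.val) : v i = x := if_neg hi.ne'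
  let chain : Scenario n t := crashChain m hmt v
  let mid : Fin n := ⟨m, by omega⟩
  let last : Fin n := ⟨m + 1, hmn⟩
  have hv : v.Surjective :=
    Value.surjective_of_ne (i := ⟨0, by omega⟩) (j := mid) (by rwa [hvpos mid hm])
  have hlast : chain.seen m last = {chain.initVal last} := seen_eq_singleton fun z hz => by
    obtain ⟨j, hj, rfl⟩ := exists_initVal_of_mem_seen_crashChain le_rfl m.lt_succ_self hz
    rw [hvpos j hj]
    exact (hvpos last m.succ_pos).symm
  have hmid : chain.seen m mid = Finset.univ :=
    Value.finset_eq_univ_of_ne (initVal_zero_mem_seen_crashChain hmt v _)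
      (chain.initVal_mem_seen m mid) (hy.trans_eq (hvpos mid hm).symm)
  have hfrom : Indist m (failureFree fun _ => x) chain :=
    ⟨last, mem_alive_failureFree _ m last, mem_alive_crashChain hmt v m.le_succ m, by
      rw [hlast, seen_failureFree_const]
      exact congrArg _ (hvpos last m.succ_pos).symm, (hvpos last m.succ_pos).symm⟩
  have hto : Indist m chain (failureFree v) :=
    indist_failureFree_of_seen_eq_univ hm (mem_alive_crashChain hmt v le_rfl m) hmid hv rfl
  exact ⟨v, hv, hfrom.reachable.trans hto.reachable⟩

theorem exists_reachable_failureFree_surjective (hm : 0 < m) (hmt : m ≤ t) (hmn : m + 1 < n)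
    (hs : (s.alive m).Nonempty) :
    ∃ v : Fin n → Value, v.Surjective ∧ Reachable m s (failureFree v) := by
  obtain ⟨i, hi⟩ := hs
  by_cases hseen : ∀ x ∈ s.seen m i, x = s.initVal i
  · have hconst : Indist m s (failureFree fun _ => s.initVal i) :=
      ⟨i, hi, mem_alive_failureFree _ m i,
        (seen_eq_singleton hseen).trans (seen_failureFree_const _ m i).symm, rfl⟩
    obtain ⟨v, hv, h⟩ :=
      exists_reachable_failureFree_surjective_of_const (n := n) hm hmt hmn (s.initVal i)
    exact ⟨v, hv, hconst.reachable.trans h⟩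
  · push Not at hseen
    obtain ⟨x, hx, hne⟩ := hseen
    obtain ⟨j, rfl⟩ := exists_initVal_of_mem_seen hx
    have huniv := Value.finset_eq_univ_of_ne hx (s.initVal_mem_seen m i) hne
    exact ⟨s.initVal, Value.surjective_of_ne hne,
      (indist_failureFree_of_seen_eq_univ hm hi huniv (Value.surjective_of_ne hne)
        rfl).reachable⟩

theorem indist_zero_of_initVal_eq (h : s.initVal i = s'.initVal i) : Indist 0 s s' :=
  ⟨i, s.mem_alive_zero i, s'.mem_alive_zero i, congrArg _ h, h⟩

theorem reachable_zero (hn : 1 < n) (s s' : Scenario n t) : Reachable 0 s s' := by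
  obtain ⟨i, j, hij⟩ := Fintype.one_lt_card_iff.1 (hn.trans_eq (Fintype.card_fin n).symm)
  let c : Scenario n t := failureFree (Function.update s.initVal j (s'.initVal j))
  have hi : s.initVal i = c.initVal i := (Function.update_of_ne hij _ _).symm
  have hj : c.initVal j = s'.initVal j := Function.update_self _ _ _
  exact (indist_zero_of_initVal_eq hi).reachable.trans (indist_zero_of_initVal_eq hj).reachable

theorem reachable_of_lt (hm : m < min (t + 1) (n - 1)) (hs : (s.alive m).Nonempty)
    (hs' : (s'.alive m).Nonempty) : Reachable m s s' := by
  rcases m.eq_zero_or_pos with rfl | hpos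
  · exact reachable_zero (by omega) s s'
  have hmt : m ≤ t := by omega
  have hmn : m + 1 < n := by omega
  obtain ⟨u, hu, hsu⟩ := exists_reachable_failureFree_surjective hpos hmt hmn hs
  obtain ⟨v, hv, hsv⟩ := exists_reachable_failureFree_surjective hpos hmt hmn hs'
  exact (hsu.trans (reachable_failureFree_of_surjective (by omega) hpos hu hv)).trans hsv.symm

theorem not_sat_common_existsVal (P : DecisionProtocol (flood n))
    (hm : m < min (t + 1) (n - 1)) (hs : (s.alive m).Nonempty) (x : Value) :
    ¬ Sat (system (flood n) P t) (.common (.atom (.existsVal x))) (s.run P) m := by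
  intro h
  obtain ⟨y, hy⟩ := exists_ne x
  have ⟨i, _⟩ := hs
  let c : Scenario n t := failureFree fun _ => y
  have hi : i ∈ c.alive m := mem_alive_failureFree _ m i
  have hc := (reachable_of_lt hm hs ⟨i, hi⟩).sat_common h
  obtain ⟨j, hj⟩ := hc.of_common (c.run_mem_runs P) ((c.nonfailed_run P m).symm ▸ hi)
  exact hy (hasInit_run.1 hj)

end Scenario

section FloodSet

open Scenario

variable {n t : ℕ} {P : DecisionProtocol (flood n)} {r : Run (flood n)} {m : ℕ} {i : Fin n}

theorem nonfailed_nonempty (ht : t < n) (hr : r ∈ Runs (flood n) P t) (m : ℕ) :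
    (Nonfailed r m).Nonempty := by
  obtain ⟨s, rfl⟩ := mem_runs_iff.1 hr
  exact s.nonfailed_run P m ▸ s.alive_nonempty ht m

theorem sat_knowsCommonValue_iff (hr : r ∈ Runs (flood n) P t) (hi : i ∈ Nonfailed r m) :
    Sat (system (flood n) P t) (knowsCommonValue i) r m ↔ min (t + 1) (n - 1) ≤ m := by
  obtain ⟨s, rfl⟩ := mem_runs_iff.1 hr
  have halive : i ∈ s.alive m := s.nonfailed_run P m ▸ hi
  rw [sat_knowsCommonValue]
  constructor
  · rintro ⟨x, hx⟩
    by_contra! hm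
    exact not_sat_common_existsVal P hm ⟨i, halive⟩ x (hx _ hr m rfl)
  · refine fun hm => ⟨s.initVal i, Sat.know_common ?_ hi⟩
    refine sat_common_existsVal P hm fun j hj => ?_
    exact s.seenUniform_of_le hm i halive j hj ▸ s.initVal_mem_seen m i

theorem decides_floodPlus_iff {s : Scenario n t} {x : Value} :
    Decides (floodPlus n t) (s.run P) m i x ↔ i ∈ s.alive m ∧ min (t + 1) (n - 1) ≤ m ∧
      (s.seen m i).min' ⟨s.initVal i, s.initVal_mem_seen m i⟩ = x := by
  rw [Decides, nonfailed_run]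
  refine and_congr_right fun hi => ?_
  have hne : (s.seen m i).Nonempty := ⟨s.initVal i, s.initVal_mem_seen m i⟩
  rw [loc_run_of_mem_alive P hi]
  by_cases hm : min (t + 1) (n - 1) ≤ m
  · simp [floodPlus, hne, hm]
  · simp [floodPlus, hm]

theorem exists_decides_floodPlus (hr : r ∈ Runs (flood n) P t) (hi : i ∈ Nonfailed r m)
    (hm : min (t + 1) (n - 1) ≤ m) : ∃ x, Decides (floodPlus n t) r m i x := by
  obtain ⟨s, rfl⟩ := mem_runs_iff.1 hr
  exact ⟨_, decides_floodPlus_iff.2 ⟨s.nonfailed_run P m ▸ hi, hm, rfl⟩⟩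

theorem isSBA_floodPlus : IsSBA (flood n) t (floodPlus n t) where
  agreement r hr m m' i j x x' h h' := by
    obtain ⟨s, rfl⟩ := mem_runs_iff.1 hr
    obtain ⟨hi, hm, rfl⟩ := decides_floodPlus_iff.1 h
    obtain ⟨hj, hm', rfl⟩ := decides_floodPlus_iff.1 h'
    have huniform := s.seenUniform_of_le le_rfl
    have hi₀ := s.alive_antitone hm hi
    have hseen : s.seen m i = s.seen m' j :=
      (huniform.seen_eq hm hi hi₀).trans (huniform.seen_eq hm' hj hi₀).symm
    simp only [hseen]
  validity r hr m i x h := by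
    obtain ⟨s, rfl⟩ := mem_runs_iff.1 hr
    obtain ⟨-, -, rfl⟩ := decides_floodPlus_iff.1 h
    obtain ⟨j, hj⟩ := exists_initVal_of_mem_seen (Finset.min'_mem (s.seen m i) _)
    exact ⟨j, hasInit_run.2 hj⟩
  simultaneity r hr m i x h j hj := by
    obtain ⟨s, rfl⟩ := mem_runs_iff.1 hr
    exact exists_decides_floodPlus hr hj (decides_floodPlus_iff.1 h).2.1

theorem Correspond.nonfailed_eq {P' : DecisionProtocol (flood n)} {r' : Run (flood n)}
    (h : Correspond r r') (hr : r ∈ Runs (flood n) P t) (hr' : r' ∈ Runs (flood n) P' t) (m : ℕ) :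
    Nonfailed r m = Nonfailed r' m := by
  obtain ⟨s, rfl⟩ := mem_runs_iff.1 hr
  obtain ⟨s', rfl⟩ := mem_runs_iff.1 hr'
  have hadv : s.adv = s'.adv := h.2
  simp only [nonfailed_run, alive, hadv]

theorem isOptimumSBA_floodPlus : IsOptimumSBA (flood n) t (floodPlus n t) := by
  refine ⟨isSBA_floodPlus, fun P hP r hr r' hr' hcorr m i x h => ?_⟩
  have hm := (sat_knowsCommonValue_iff hr h.1).1 (hP.sat_knowsCommonValue hr h)
  exact exists_decides_floodPlus hr' (hcorr.nonfailed_eq hr hr' m ▸ h.1) hm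

theorem terminates_floodPlus : Terminates (flood n) t (floodPlus n t) := by
  refine fun r hr i => ⟨min (t + 1) (n - 1), or_iff_not_imp_left.2 fun hi => ?_⟩
  exact exists_decides_floodPlus hr (not_not.1 hi) le_rfl

end FloodSet

end SBA

theorem mainTheorem4 (n t : ℕ) (ht : t ≤ n) :
    (∀ P : SBA.DecisionProtocol (SBA.flood n),
      ∀ r ∈ (SBA.system (SBA.flood n) P t).runs, ∀ m : ℕ,
        (∀ i ∈ SBA.Nonfailed r m,
          (SBA.Sat (SBA.system (SBA.flood n) P t) (SBA.knowsCommonValue i) r m ↔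
            min (t + 1) (n - 1) ≤ m)) ∧
        (t < n →
          ((∀ i ∈ SBA.Nonfailed r m,
            SBA.Sat (SBA.system (SBA.flood n) P t) (SBA.knowsCommonValue i) r m) ↔
              min (t + 1) (n - 1) ≤ m))) ∧
    SBA.IsOptimumSBA (SBA.flood n) t (SBA.floodPlus n t) ∧
    SBA.Terminates (SBA.flood n) t (SBA.floodPlus n t) := by
  refine ⟨fun P r hr m => ⟨fun i hi => SBA.sat_knowsCommonValue_iff hr hi, fun htn => ?_⟩,
    SBA.isOptimumSBA_floodPlus, SBA.terminates_floodPlus⟩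
  obtain ⟨i, hi⟩ := SBA.nonfailed_nonempty htn hr m
  exact ⟨fun h => (SBA.sat_knowsCommonValue_iff hr hi).1 (h i hi),
    fun hm j hj => (SBA.sat_knowsCommonValue_iff hr hj).2 hm⟩
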